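/- Theorem 4.3. Let $\ell_2$ be the real Hilbert space of square-summable sequences with its usual norm $\|\cdot\|$, and for a differentiable function $f:\ell_2\to\mathbb{R}$ let $\mathcal{C}(f)=\{\lambda f'(x):\lambda\ge 0,\ x\in\ell_2\}\subseteq \ell_2^*$ be the cone generated by its set of derivatives, where $\ell_2^*$ carries the dual norm. Then the following hold. (1) For every $\varepsilon>0$ there is a $C^1$ Lipschitz function $\psi:\ell_2\to\mathbb{R}$ with Lipschitz derivative $\psi':\ell_2\to\ell_2^*$ such that $|\psi(x)-\|x\||\le\varepsilon$ for all $x\in\ell_2$, the cone $\mathcal{C}(\psi)$ has empty interior in $\ell_2^*$, and $\psi'(x)\ne 0$ for all $x\in\ell_2$. (2) There is a $C^1$ Lipschitz function $b:\ell_2\to\mathbb{R}$ with Lipschitz derivative that is a bump function (that is, $b$ is not identically zero and its support $\operatorname{supp} b=\overline{\{x: b(x)\ne 0\}}$ is bounded) such that the cone $\mathcal{C}(b)$ has empty interior in $\ell_2^*$ and $b'(x)\ne 0$ for every $x$ in the interior of $\operatorname{supp} b$. -/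

import Mathlib

/-- The real Hilbert space of square-summable real sequences, with its usual norm. -/
abbrev Ell2 : Type := lp (fun _ : ℕ => ℝ) 2

/-- The cone generated by the set of derivatives of a (differentiable) function,
a subset of the dual space with its operator norm. -/
def derivativeCone {E : Type*} [NormedAddCommGroup E] [NormedSpace ℝ E] (f : E → ℝ) :
    Set (E →L[ℝ] ℝ) :=
  {g | ∃ c : ℝ, 0 ≤ c ∧ ∃ x : E, g = c • fderiv ℝ f x}

/-- A bump function: not identically zero, and with bounded support, the support being the
closure of the set where the function does not vanish. -/
def IsBump {E : Type*} [NormedAddCommGroup E] (b : E → ℝ) : Prop :=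
  (∃ x, b x ≠ 0) ∧ Bornology.IsBounded (tsupport b)

/-- A continuously differentiable Lipschitz function with Lipschitz derivative. -/
def IsC1LipschitzWithLipschitzDeriv {E : Type*} [NormedAddCommGroup E] [NormedSpace ℝ E]
    (f : E → ℝ) : Prop :=
  ContDiff ℝ 1 f ∧ (∃ K : NNReal, LipschitzWith K f) ∧
    ∃ M : NNReal, LipschitzWith M (fderiv ℝ f)

/-! The goal is a function near the norm whose gradient never enters a dense subspace `D`.
Nonnegative multiples of such gradients miss `D \ {0}`, which is still dense, so the cone has empty
interior. The seed is a function at bounded distance from `‖u‖ ^ 2` whose Lipschitz gradient never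
vanishes (`exists_lipschitz_gradient_ne_zero`). It adds a cut-off quadratic form of the free Jacobi
operator `J` and subtracts a cut-off linear form `⟪e, u⟫`. A critical point would solve `μ u + χ J u
= ζ e`, which a conserved energy of the three-term recurrence excludes. Small rescaled copies of the
seed are summed over a Hilbert sum of copies of `ℓ²`, itself isometric to `ℓ²`. Every block of the
gradient is nonzero, so the gradient is never finitely supported: this supplies `D`
(`exists_lipschitz_gradient_notMem_dense`). Finally `ψ = √(f + const)` is close to the norm, and
`max 0 (1 - ψ) ^ 2` is the bump. Both gradients are scalar multiples of that of `f`. -/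

open scoped InnerProductSpace

/-! ### Quadratic remainders, bounded Lipschitz maps and cutoffs -/

section Calculus

/-- Quadratic remainder bounds add up over the blocks of a Hilbert sum, which makes this criterion
suitable for infinite sums. -/
theorem hasFDerivAt_of_norm_sub_le_sq {E F : Type*} [NormedAddCommGroup E] [NormedSpace ℝ E]
    [NormedAddCommGroup F] [NormedSpace ℝ F] {f : E → F} {f' : E →L[ℝ] F} {x : E} {C : ℝ}
    (h : ∀ y, ‖f y - f x - f' (y - x)‖ ≤ C * ‖y - x‖ ^ 2) : HasFDerivAt f f' x := by
  refine .of_isLittleO ?_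
  have h1 : (fun y => f y - f x - f' (y - x)) =O[nhds x] fun y => ‖y - x‖ ^ 2 :=
    Asymptotics.IsBigO.of_bound C (.of_forall fun y => by simpa using h y)
  refine h1.trans_isLittleO ?_
  have h2 : (fun z : E => ‖z‖ ^ 2) =o[nhds 0] fun z => z := Asymptotics.isLittleO_norm_pow_id one_lt_two
  have h3 : Filter.Tendsto (fun y => y - x) (nhds x) (nhds 0) := by
    simpa using (continuous_id.sub continuous_const).tendsto x (f := fun y : E => y - x)
  exact h2.comp_tendsto h3

theorem norm_sub_le_sq_of_lipschitz_fderiv {E F : Type*} [NormedAddCommGroup E] [NormedSpace ℝ E]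
    [NormedAddCommGroup F] [NormedSpace ℝ F] {f : E → F} {f' : E → E →L[ℝ] F} {C : ℝ} (hC : 0 ≤ C)
    (hf : ∀ x, HasFDerivAt f (f' x) x) (hL : ∀ x y, ‖f' x - f' y‖ ≤ C * ‖x - y‖) (x y : E) :
    ‖f y - f x - f' x (y - x)‖ ≤ C * ‖y - x‖ ^ 2 := by
  have h := (convex_closedBall x ‖y - x‖).norm_image_sub_le_of_norm_hasFDerivWithin_le'
    (f := f) (f' := f') (φ := f' x) (C := C * ‖y - x‖) (x := x) (y := y)
    (fun z _ => (hf z).hasFDerivWithinAt)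
    (fun z hz => (hL z x).trans (by
      rw [mem_closedBall_iff_norm] at hz
      gcongr)) (by simp) (by simp [dist_eq_norm])
  calc _ ≤ _ := h
    _ = _ := by ring

theorem hasDerivAt_max_zero_sq (s : ℝ) : HasDerivAt (fun t : ℝ => max 0 t ^ 2) (2 * max 0 s) s := by
  rw [hasDerivAt_iff_hasFDerivAt]
  refine hasFDerivAt_of_norm_sub_le_sq (C := 1) fun t => ?_
  simp only [ContinuousLinearMap.toSpanSingleton_apply, smul_eq_mul, Real.norm_eq_abs, sq_abs]
  rw [abs_le]
  rcases max_cases 0 t with ⟨h1, h2⟩ | ⟨h1, h2⟩ <;> rcases max_cases 0 s with ⟨h3, h4⟩ | ⟨h3, h4⟩ <;>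
    rw [h1, h3] <;> constructor <;> nlinarith

/-- `F` is bounded and Lipschitz on `s`. -/
def BoundedLipschitzOn {E F : Type*} [NormedAddCommGroup E] [NormedAddCommGroup F]
    (F : E → F) (s : Set E) : Prop :=
  ∃ K : ℝ, 0 ≤ K ∧ (∀ x ∈ s, ‖F x‖ ≤ K) ∧ ∀ x ∈ s, ∀ y ∈ s, ‖F x - F y‖ ≤ K * ‖x - y‖

namespace BoundedLipschitzOn

variable {E F : Type*} [NormedAddCommGroup E] [NormedAddCommGroup F] {s : Set E}

theorem mono {f : E → F} {t : Set E} (h : BoundedLipschitzOn f t) (hs : s ⊆ t) :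
    BoundedLipschitzOn f s := by
  obtain ⟨K, h0, h1, h2⟩ := h
  exact ⟨K, h0, fun x hx => h1 x (hs hx), fun x hx y hy => h2 x (hs hx) y (hs hy)⟩

theorem const (a : F) : BoundedLipschitzOn (fun _ : E => a) s :=
  ⟨‖a‖, norm_nonneg _, fun _ _ => le_rfl, fun x _ y _ => by simp; positivity⟩

theorem sub {f g : E → F} (hf : BoundedLipschitzOn f s) (hg : BoundedLipschitzOn g s) :
    BoundedLipschitzOn (fun x => f x - g x) s := by
  obtain ⟨K, h0, h1, h2⟩ := hf
  obtain ⟨M, k0, k1, k2⟩ := hg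
  refine ⟨K + M, by positivity, fun x hx => (norm_sub_le _ _).trans (add_le_add (h1 x hx) (k1 x hx)),
    fun x hx y hy => ?_⟩
  calc ‖f x - g x - (f y - g y)‖ = ‖(f x - f y) - (g x - g y)‖ := by congr 1; abel
    _ ≤ _ := (norm_sub_le _ _).trans (add_le_add (h2 x hx y hy) (k2 x hx y hy))
    _ = _ := by ring

theorem smul [NormedSpace ℝ F] {f : E → ℝ} {g : E → F} (hf : BoundedLipschitzOn f s)
    (hg : BoundedLipschitzOn g s) :
    BoundedLipschitzOn (fun x => f x • g x) s := by
  obtain ⟨K, h0, h1, h2⟩ := hf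
  obtain ⟨M, k0, k1, k2⟩ := hg
  refine ⟨K * M + K * M, by positivity, fun x hx => ?_, fun x hx y hy => ?_⟩
  · rw [norm_smul]
    have := mul_le_mul (h1 x hx) (k1 x hx) (norm_nonneg _) h0
    nlinarith [mul_nonneg h0 k0]
  · calc ‖f x • g x - f y • g y‖ = ‖f x • (g x - g y) + (f x - f y) • g y‖ := by
          congr 1; rw [smul_sub, sub_smul]; abel
      _ ≤ ‖f x‖ * ‖g x - g y‖ + ‖f x - f y‖ * ‖g y‖ := by
          rw [← norm_smul, ← norm_smul]; exact norm_add_le _ _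
      _ ≤ K * (M * ‖x - y‖) + (K * ‖x - y‖) * M := by
          gcongr
          exacts [h1 x hx, k2 x hx y hy, h2 x hx y hy, k1 y hy]
      _ = _ := by ring

theorem clm_comp [NormedSpace ℝ F] {G : Type*} [NormedAddCommGroup G] [NormedSpace ℝ G]
    {f : E → F} (hf : BoundedLipschitzOn f s) (T : F →L[ℝ] G) : BoundedLipschitzOn (fun x => T (f x)) s := by
  obtain ⟨K, h0, h1, h2⟩ := hf
  refine ⟨‖T‖ * K, by positivity, fun x hx => (T.le_opNorm _).trans (by gcongr; exact h1 x hx),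
    fun x hx y hy => ?_⟩
  rw [← map_sub, mul_assoc]
  exact (T.le_opNorm _).trans (by gcongr; exact h2 x hx y hy)

theorem id_closedBall (R : ℝ) : BoundedLipschitzOn (fun x : E => x) (Metric.closedBall 0 R) :=
  ⟨max R 1, by positivity, fun x hx => by
    rw [mem_closedBall_zero_iff] at hx; exact hx.trans (le_max_left _ _),
    fun x _ y _ => le_mul_of_one_le_left (norm_nonneg _) (le_max_right _ _)⟩

theorem inner_self_apply {E : Type*} [NormedAddCommGroup E] [InnerProductSpace ℝ E] {s : Set E}
    {f g : E → E} (hf : BoundedLipschitzOn f s) (hg : BoundedLipschitzOn g s) :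
    BoundedLipschitzOn (fun x => ⟪f x, g x⟫_ℝ) s := by
  obtain ⟨K, h0, h1, h2⟩ := hf
  obtain ⟨M, k0, k1, k2⟩ := hg
  refine ⟨K * M + K * M, by positivity, fun x hx => ?_, fun x hx y hy => ?_⟩
  · have := mul_le_mul (h1 x hx) (k1 x hx) (norm_nonneg _) h0
    have := norm_inner_le_norm (𝕜 := ℝ) (f x) (g x)
    nlinarith [mul_nonneg h0 k0]
  · calc ‖⟪f x, g x⟫_ℝ - ⟪f y, g y⟫_ℝ‖ = ‖⟪f x, g x - g y⟫_ℝ + ⟪f x - f y, g y⟫_ℝ‖ := by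
          congr 1; rw [inner_sub_right, inner_sub_left]; abel
      _ ≤ ‖f x‖ * ‖g x - g y‖ + ‖f x - f y‖ * ‖g y‖ :=
          (norm_add_le _ _).trans (add_le_add (norm_inner_le_norm _ _) (norm_inner_le_norm _ _))
      _ ≤ K * (M * ‖x - y‖) + (K * ‖x - y‖) * M := by
          gcongr
          exacts [h1 x hx, k2 x hx y hy, h2 x hx y hy, k1 y hy]
      _ = _ := by ring

/-- A product with a scalar factor vanishing off `s` is globally Lipschitz if the other factor is
bounded and Lipschitz on `s`. -/
theorem lipschitz_smul [NormedSpace ℝ F] {f : E → ℝ} {g : E → F} (hf : BoundedLipschitzOn f Set.univ)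
    (hg : BoundedLipschitzOn g s) (h0 : ∀ x ∉ s, f x = 0) :
    ∃ C : ℝ, 0 ≤ C ∧ ∀ x y, ‖f x • g x - f y • g y‖ ≤ C * ‖x - y‖ := by
  obtain ⟨C, hC, -, hC'⟩ := (hf.mono (Set.subset_univ s)).smul hg
  obtain ⟨K, k0, k1, k2⟩ := hf
  obtain ⟨M, m0, m1, m2⟩ := hg
  -- For `y` outside `s`, `‖f x‖ = ‖f x - f y‖` is already of order `‖x - y‖`, so only the bound on
  -- `g x` is needed, not `g y`.
  have key : ∀ x ∈ s, ∀ y ∉ s, ‖f x • g x - f y • g y‖ ≤ (K * M) * ‖x - y‖ := by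
    intro x hx y hy
    have h := k2 x trivial y trivial
    rw [h0 y hy, sub_zero] at h
    rw [h0 y hy, zero_smul, sub_zero, norm_smul]
    calc _ ≤ (K * ‖x - y‖) * M := by gcongr; exact m1 x hx
      _ = _ := by ring
  refine ⟨C + K * M, by positivity, fun x y => ?_⟩
  have e1 : 0 ≤ C * ‖x - y‖ := by positivity
  have e2 : 0 ≤ K * M * ‖x - y‖ := by positivity
  rw [add_mul]
  by_cases hx : x ∈ s <;> by_cases hy : y ∈ s
  · linarith [hC' x hx y hy]
  · linarith [key x hx y hy]
  · rw [norm_sub_rev, norm_sub_rev x y] at *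
    linarith [key y hy x hx]
  · simp only [h0 x hx, h0 y hy, zero_smul, sub_zero, norm_zero]
    linarith

end BoundedLipschitzOn

/-- The truncated paraboloid supported in the closed ball of radius `R`. -/
noncomputable def cutoff {E : Type*} [NormedAddCommGroup E] (R : ℝ) (u : E) : ℝ :=
  max 0 (1 - ‖u‖ ^ 2 / R ^ 2)

section Cutoff

variable {E : Type*} [NormedAddCommGroup E] {R : ℝ}

theorem cutoff_nonneg (R : ℝ) (u : E) : 0 ≤ cutoff R u := le_max_left _ _

theorem cutoff_le_one (R : ℝ) (u : E) : cutoff R u ≤ 1 :=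
  max_le zero_le_one (by linarith [show 0 ≤ ‖u‖ ^ 2 / R ^ 2 by positivity])

theorem cutoff_eq_zero (hR : 0 < R) {u : E} (hu : R ≤ ‖u‖) : cutoff R u = 0 := by
  refine max_eq_left ?_
  rw [sub_nonpos, one_le_div (by positivity)]
  gcongr

theorem boundedLipschitzOn_cutoff (hR : 0 < R) :
    BoundedLipschitzOn (cutoff R : E → ℝ) Set.univ := by
  -- Clamping the norm at `R` reduces the Lipschitz bound to a difference of squares of numbers in
  -- `[0, R]`.
  have hm : ∀ u : E, cutoff R u = 1 - (min ‖u‖ R) ^ 2 / R ^ 2 := by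
    intro u
    rcases le_total ‖u‖ R with h | h
    · rw [min_eq_left h, cutoff, max_eq_right]
      rw [sub_nonneg, div_le_one (by positivity)]
      gcongr
    · rw [min_eq_right h, cutoff_eq_zero hR h, div_self (by positivity), sub_self]
  refine ⟨max 1 (2 / R), by positivity, fun u _ => ?_, fun x _ y _ => ?_⟩
  · rw [Real.norm_of_nonneg (cutoff_nonneg _ _)]
    exact (cutoff_le_one R u).trans (le_max_left _ _)
  · refine le_trans ?_ (mul_le_mul_of_nonneg_right (le_max_right 1 (2 / R)) (norm_nonneg _))
    have h1 : |min ‖x‖ R - min ‖y‖ R| ≤ ‖x - y‖ := by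
      refine (abs_min_sub_min_le_max _ _ _ _).trans ?_
      simpa using abs_norm_sub_norm_le x y
    have h2 : |min ‖x‖ R + min ‖y‖ R| ≤ 2 * R := by
      rw [abs_of_nonneg (by positivity)]
      linarith [min_le_right ‖x‖ R, min_le_right ‖y‖ R]
    rw [hm, hm, Real.norm_eq_abs]
    have : 1 - min ‖x‖ R ^ 2 / R ^ 2 - (1 - min ‖y‖ R ^ 2 / R ^ 2)
        = -((min ‖x‖ R + min ‖y‖ R) * (min ‖x‖ R - min ‖y‖ R)) / R ^ 2 := by ring
    rw [this, abs_div, abs_neg, abs_mul, abs_of_pos (by positivity : 0 < R ^ 2),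
      div_le_iff₀ (by positivity)]
    calc _ ≤ (2 * R) * ‖x - y‖ := by gcongr
      _ = _ := by field_simp

theorem abs_cutoff_sq_mul_le (hR : 0 < R) {p : E → ℝ}
    (hp : BoundedLipschitzOn p (Metric.closedBall 0 R)) :
    ∃ C : ℝ, 0 ≤ C ∧ ∀ x, |cutoff R x ^ 2 * p x| ≤ C := by
  obtain ⟨K, h0, h1, -⟩ := hp
  refine ⟨K, h0, fun x => ?_⟩
  by_cases hx : x ∈ Metric.closedBall (0 : E) R
  · rw [abs_mul, abs_of_nonneg (sq_nonneg _)]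
    exact (mul_le_of_le_one_left (abs_nonneg _)
      (pow_le_one₀ (cutoff_nonneg _ _) (cutoff_le_one _ _))).trans (h1 x hx)
  · rw [mem_closedBall_zero_iff, not_le] at hx
    simpa [cutoff_eq_zero hR hx.le]

end Cutoff

section CutoffMul

variable {E : Type*} [NormedAddCommGroup E] [InnerProductSpace ℝ E] {R : ℝ}

/-- The gradient of `cutoff R ^ 2 * p`, where `P` is the gradient of `p`. -/
noncomputable def cutoffMulGradient (R : ℝ) (p : E → ℝ) (P : E → E) (u : E) : E :=
  cutoff R u • (cutoff R u • P u - (4 / R ^ 2 * p u) • u)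

theorem hasFDerivAt_norm_sq_inner (u : E) :
    HasFDerivAt (fun u : E => ‖u‖ ^ 2) (innerSL ℝ ((2 : ℝ) • u)) u := by
  refine (hasStrictFDerivAt_norm_sq u).hasFDerivAt.congr_fderiv ?_
  ext v
  simp

theorem hasFDerivAt_cutoff_sq_mul {p : E → ℝ} {P : E → E}
    (hp : ∀ u, HasFDerivAt p (innerSL ℝ (P u)) u) (u : E) :
    HasFDerivAt (fun u => cutoff R u ^ 2 * p u) (innerSL ℝ (cutoffMulGradient R p P u)) u := by
  have h1 : HasFDerivAt (fun u : E => 1 - ‖u‖ ^ 2 / R ^ 2)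
      (-((R ^ 2)⁻¹ • innerSL ℝ ((2 : ℝ) • u))) u := by
    simp only [div_eq_mul_inv]
    exact ((hasFDerivAt_norm_sq_inner u).mul_const _).const_sub 1
  have h2 := ((hasDerivAt_max_zero_sq _).comp_hasFDerivAt u h1).mul (hp u)
  refine h2.congr_fderiv ?_
  ext v
  simp [cutoffMulGradient, cutoff]
  ring

/-- Squaring the cutoff leaves one factor of it in the gradient; this factor vanishes off the ball,
so bounds on the ball suffice. -/
theorem lipschitz_cutoffMulGradient (hR : 0 < R) {p : E → ℝ} {P : E → E}
    (hp : BoundedLipschitzOn p (Metric.closedBall 0 R))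
    (hP : BoundedLipschitzOn P (Metric.closedBall 0 R)) :
    ∃ C : ℝ, 0 ≤ C ∧ ∀ x y,
      ‖cutoffMulGradient R p P x - cutoffMulGradient R p P y‖ ≤ C * ‖x - y‖ := by
  refine (boundedLipschitzOn_cutoff hR).lipschitz_smul
    ((((boundedLipschitzOn_cutoff hR).mono (Set.subset_univ _)).smul hP).sub
      (((BoundedLipschitzOn.const (4 / R ^ 2)).smul hp).smul (.id_closedBall R))) fun x hx => ?_
  rw [mem_closedBall_zero_iff, not_le] at hx
  exact cutoff_eq_zero hR hx.le

end CutoffMul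

end Calculus

/-! ### The Jacobi operator and a seed function without critical points -/

section Model

theorem Ell2.memℓp_iff {f : ℕ → ℝ} : Memℓp f 2 ↔ Summable fun n => f n ^ 2 := by
  simp [memℓp_gen_iff (p := 2) (by norm_num : 0 < (2 : ENNReal).toReal)]

theorem Ell2.hasSum_sq (u : Ell2) : HasSum (fun n => u n ^ 2) (‖u‖ ^ 2) := by
  simpa using lp.hasSum_norm (p := 2) (by norm_num : 0 < (2 : ENNReal).toReal) u

theorem Ell2.tendsto_zero (u : Ell2) : Filter.Tendsto (fun n => u n) Filter.atTop (nhds 0) := by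
  have h2 := u.hasSum_sq.summable.tendsto_atTop_zero.sqrt
  simp only [Real.sqrt_zero, Real.sqrt_sq_eq_abs] at h2
  exact (tendsto_zero_iff_abs_tendsto_zero _).2 h2

/-- The left shift on `ℓ²`. -/
noncomputable def leftShift : Ell2 →L[ℝ] Ell2 :=
  LinearMap.mkContinuous
    { toFun := fun u => (⟨fun n => u (n + 1), Ell2.memℓp_iff.2
        ((summable_nat_add_iff 1).2 u.hasSum_sq.summable)⟩ : Ell2)
      map_add' := fun u v => rfl
      map_smul' := fun c u => rfl } 1 fun u => by
    rw [one_mul]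
    refine (sq_le_sq₀ (norm_nonneg _) (norm_nonneg _)).1 ?_
    rw [← (Ell2.hasSum_sq _).tsum_eq, ← u.hasSum_sq.tsum_eq, u.hasSum_sq.summable.tsum_eq_zero_add]
    exact le_add_of_nonneg_left (sq_nonneg _)

@[simp]
theorem leftShift_apply (u : Ell2) (n : ℕ) : leftShift u n = u (n + 1) := rfl

theorem norm_leftShift_le : ‖leftShift‖ ≤ 1 := LinearMap.mkContinuous_norm_le _ zero_le_one _

/-- The discrete free Jacobi operator: the left shift plus its adjoint. -/
noncomputable def jacobi : Ell2 →L[ℝ] Ell2 := leftShift + ContinuousLinearMap.adjoint leftShift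

theorem norm_jacobi_le : ‖jacobi‖ ≤ 2 := by
  refine (norm_add_le _ _).trans ?_
  rw [LinearIsometryEquiv.norm_map]
  linarith [norm_leftShift_le]

theorem Ell2.apply_eq_inner (u : Ell2) (n : ℕ) : u n = ⟪lp.single 2 n (1 : ℝ), u⟫_ℝ := by
  simp [lp.inner_single_left]

theorem jacobi_apply_zero (u : Ell2) : jacobi u 0 = u 1 := by
  have : leftShift (lp.single 2 0 (1 : ℝ)) = 0 := by
    ext n; simp
  simp only [jacobi, add_apply, lp.coeFn_add, Pi.add_apply, leftShift_apply]
  rw [Ell2.apply_eq_inner (ContinuousLinearMap.adjoint leftShift u),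
    ContinuousLinearMap.adjoint_inner_right, this]
  simp

theorem jacobi_apply_succ (u : Ell2) (n : ℕ) : jacobi u (n + 1) = u (n + 2) + u n := by
  have : leftShift (lp.single 2 (n + 1) (1 : ℝ)) = lp.single 2 n 1 := by
    ext m; simp [Pi.single_apply]
  simp only [jacobi, add_apply, lp.coeFn_add, Pi.add_apply, leftShift_apply]
  rw [Ell2.apply_eq_inner (ContinuousLinearMap.adjoint leftShift u),
    ContinuousLinearMap.adjoint_inner_right, this, ← Ell2.apply_eq_inner]

theorem inner_jacobi (u v : Ell2) : ⟪jacobi u, v⟫_ℝ = ⟪u, jacobi v⟫_ℝ := by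
  simp [jacobi, inner_add_left, inner_add_right, ContinuousLinearMap.adjoint_inner_left,
    ContinuousLinearMap.adjoint_inner_right, add_comm]

variable {u : Ell2} {μ χ ζ : ℝ}

/-- A square-summable solution of the three-term recurrence has vanishing energy. -/
theorem jacobi_energy_eq_zero (h : μ • u + χ • jacobi u = ζ • lp.single 2 0 (1 : ℝ)) :
    χ * (u 0 ^ 2 + u 1 ^ 2) + μ * (u 0 * u 1) = 0 := by
  have hn : ∀ n, μ * u (n + 1) + χ * (u (n + 2) + u n) = 0 := fun n => by
    have : μ * u (n + 1) + χ * jacobi u (n + 1) = ζ * (lp.single 2 0 (1 : ℝ) : Ell2) (n + 1) :=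
      congrArg (fun v : Ell2 => v (n + 1)) h
    simpa [jacobi_apply_succ] using this
  have hE : ∀ n, χ * (u n ^ 2 + u (n + 1) ^ 2) + μ * (u n * u (n + 1))
      = χ * (u 0 ^ 2 + u 1 ^ 2) + μ * (u 0 * u 1) := by
    intro n
    induction n with
    | zero => rfl
    | succ n ih =>
      rw [← ih]
      -- The energy increment factors as `u (n + 2) - u n` times the recurrence.
      linear_combination (u (n + 2) - u n) * hn n
  have ht := u.tendsto_zero
  have ht1 := ht.comp (Filter.tendsto_add_atTop_nat 1)
  have := (((ht.pow 2).add (ht1.pow 2)).const_mul χ).add ((ht.mul ht1).const_mul μ)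
  simp only [Function.comp_apply, hE] at this
  simpa using tendsto_nhds_unique tendsto_const_nhds this

theorem jacobi_eq_zero_zero (h : μ • u + χ • jacobi u = ζ • lp.single 2 0 (1 : ℝ)) :
    μ * u 0 + χ * u 1 = ζ := by
  have : μ * u 0 + χ * jacobi u 0 = ζ * (lp.single 2 0 (1 : ℝ) : Ell2) 0 :=
    congrArg (fun v : Ell2 => v 0) h
  simpa [jacobi_apply_zero] using this

/-- When `|μ| < 2 * χ` the energy is a positive definite form in `(u 0, u 1)`, so zero energy kills
both entries, and row zero of the equation then gives the source. -/
theorem source_eq_zero_of_jacobi (h : μ • u + χ • jacobi u = ζ • lp.single 2 0 (1 : ℝ))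
    (hμ : |μ| < 2 * χ) : ζ = 0 := by
  have hE := jacobi_energy_eq_zero h
  obtain ⟨h1, h2⟩ := abs_lt.1 hμ
  have key : (2 * χ - |μ|) * (u 0 ^ 2 + u 1 ^ 2) ≤ 0 := by
    have : -(μ * (u 0 * u 1)) ≤ |μ| * ((u 0 ^ 2 + u 1 ^ 2) / 2) := by
      refine (neg_le_abs _).trans ?_
      rw [abs_mul]
      gcongr
      rw [abs_le]
      constructor <;> nlinarith [sq_nonneg (u 0 + u 1), sq_nonneg (u 0 - u 1)]
    linarith
  have h3 : u 0 ^ 2 + u 1 ^ 2 ≤ 0 := by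
    by_contra! hc
    nlinarith
  have h0 : u 0 = 0 := by nlinarith [sq_nonneg (u 0), sq_nonneg (u 1)]
  have h1 : u 1 = 0 := by nlinarith [sq_nonneg (u 0), sq_nonneg (u 1)]
  rw [← jacobi_eq_zero_zero h, h0, h1]
  ring

/-- `J` has no eigenvectors: row zero reduces the vanishing energy to `χ * u 0 ^ 2`, and the
recurrence propagates the zeros. -/
theorem eq_zero_of_jacobi (h : μ • u + χ • jacobi u = 0) (hχ : χ ≠ 0) : u = 0 := by
  have h' : μ • u + χ • jacobi u = (0 : ℝ) • lp.single 2 0 (1 : ℝ) := by rw [h, zero_smul]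
  have hE := jacobi_energy_eq_zero h'
  have hz := jacobi_eq_zero_zero h'
  have h0 : u 0 = 0 := by
    have : χ * u 0 ^ 2 = 0 := by linear_combination hE - u 1 * hz
    simpa [hχ] using this
  have h1 : u 1 = 0 := by
    rw [h0] at hz
    simpa [hχ] using hz
  have hn : ∀ n, u n = 0 ∧ u (n + 1) = 0 := by
    intro n
    induction n with
    | zero => exact ⟨h0, h1⟩
    | succ n ih =>
      refine ⟨ih.2, ?_⟩
      have : μ * u (n + 1) + χ * jacobi u (n + 1) = 0 := congrArg (fun v : Ell2 => v (n + 1)) h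
      simpa [jacobi_apply_succ, ih.1, ih.2, hχ] using this
  ext n
  simpa using (hn n).1

theorem hasFDerivAt_inner_jacobi (u : Ell2) :
    HasFDerivAt (fun u => ⟪jacobi u, u⟫_ℝ) (innerSL ℝ ((2 : ℝ) • jacobi u)) u := by
  refine (jacobi.hasFDerivAt.inner ℝ (hasFDerivAt_id u)).congr_fderiv ?_
  ext v
  simp [inner_jacobi v u, real_inner_comm v]
  ring

/-- There is a function on `ℓ²` at bounded distance from the squared norm, with Lipschitz and
nowhere vanishing gradient. -/
theorem exists_lipschitz_gradient_ne_zero :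
    ∃ (g : Ell2 → ℝ) (G : Ell2 → Ell2) (C L : ℝ), 0 ≤ C ∧ 0 ≤ L ∧
      (∀ u, HasFDerivAt g (innerSL ℝ (G u)) u) ∧ (∀ u v, ‖G u - G v‖ ≤ L * ‖u - v‖) ∧
      (∀ u, |g u - ‖u‖ ^ 2| ≤ C) ∧ ∀ u, G u ≠ 0 := by
  set e : Ell2 := lp.single 2 0 (1 : ℝ) with he
  have he1 : ‖e‖ = 1 := by simp [he, lp.norm_single]
  set p : Ell2 → ℝ := fun u => 2 * ⟪jacobi u, u⟫_ℝ
  set P : Ell2 → Ell2 := fun u => (4 : ℝ) • jacobi u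
  set r : Ell2 → ℝ := fun u => ⟪e, u⟫_ℝ
  have hp : ∀ u, HasFDerivAt p (innerSL ℝ (P u)) u := fun u => by
    refine ((hasFDerivAt_inner_jacobi u).const_mul 2).congr_fderiv ?_
    ext v
    simp [P]
    ring
  have hr : ∀ u, HasFDerivAt r (innerSL ℝ e) u := fun u => (innerSL ℝ e).hasFDerivAt
  have id_bl := fun R : ℝ => BoundedLipschitzOn.id_closedBall (E := Ell2) R
  have hpb : ∀ R : ℝ, BoundedLipschitzOn p (Metric.closedBall 0 R) := fun R =>
    (BoundedLipschitzOn.const (2 : ℝ)).smul (((id_bl R).clm_comp jacobi).inner_self_apply (id_bl R))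
  have hPb : ∀ R : ℝ, BoundedLipschitzOn P (Metric.closedBall 0 R) := fun R =>
    (BoundedLipschitzOn.const (4 : ℝ)).smul ((id_bl R).clm_comp jacobi)
  have hrb : ∀ R : ℝ, BoundedLipschitzOn r (Metric.closedBall 0 R) := fun R =>
    (id_bl R).clm_comp (innerSL ℝ e)
  -- Radii 16 and 4: where `‖u‖ < 4` the wide cutoff is at least `15/16`, `|p u| ≤ 64` and `|r u| ≤
  -- 4`. Both corrections to the coefficient 2 of `u` are then at most 1, so `|μ| ≤ 4 < 2 * (4 *
  -- (15/16) ^ 2)`.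
  obtain ⟨C₁, hC₁, hp'⟩ := abs_cutoff_sq_mul_le (R := 16) (by norm_num) (hpb 16)
  obtain ⟨C₂, hC₂, hr'⟩ := abs_cutoff_sq_mul_le (R := 4) (by norm_num) (hrb 4)
  obtain ⟨L₁, hL₁, hP'⟩ := lipschitz_cutoffMulGradient (R := 16) (by norm_num) (hpb 16) (hPb 16)
  obtain ⟨L₂, hL₂, hR'⟩ := lipschitz_cutoffMulGradient (R := 4) (P := fun _ => e) (by norm_num)
    (hrb 4) (.const e)
  refine ⟨fun u => ‖u‖ ^ 2 + cutoff 16 u ^ 2 * p u - cutoff 4 u ^ 2 * r u,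
    fun u => (2 : ℝ) • u + cutoffMulGradient 16 p P u - cutoffMulGradient 4 r (fun _ => e) u,
    C₁ + C₂, 2 + L₁ + L₂, by positivity, by positivity, fun u => ?_, fun u v => ?_, fun u => ?_,
    fun u hu => ?_⟩
  · rw [map_sub, map_add]
    exact ((hasFDerivAt_norm_sq_inner u).add (hasFDerivAt_cutoff_sq_mul hp u)).sub
      (hasFDerivAt_cutoff_sq_mul hr u)
  · set a := cutoffMulGradient 16 p P
    set b := cutoffMulGradient 4 r (fun _ => e)
    have e1 : (2 : ℝ) • u + a u - b u - ((2 : ℝ) • v + a v - b v)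
        = (2 : ℝ) • (u - v) + (a u - a v) - (b u - b v) := by rw [smul_sub]; abel
    rw [e1]
    refine (norm_sub_le _ _).trans ?_
    refine (add_le_add_left (norm_add_le _ _) _).trans ?_
    rw [norm_smul, Real.norm_of_nonneg zero_le_two]
    linarith [hP' u v, hR' u v]
  · have h1 := abs_le.1 (hp' u)
    have h2 := abs_le.1 (hr' u)
    rw [abs_le]
    constructor <;> linarith [h1.1, h1.2, h2.1, h2.2]
  · set c := cutoff 16 u
    set d := cutoff 4 u
    have hc0 : 0 ≤ c := cutoff_nonneg _ _
    have hd0 : 0 ≤ d := cutoff_nonneg _ _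
    -- The critical point equation, in the form `μ u + χ J u = ζ e`.
    have heq : (2 - c * (4 / 16 ^ 2 * p u) + d * (4 / 4 ^ 2 * r u)) • u + (4 * c ^ 2) • jacobi u
        = (d ^ 2) • e := by
      rw [← sub_eq_zero, ← hu]
      simp only [cutoffMulGradient, P]
      module
    rcases lt_or_ge ‖u‖ 4 with h4 | h4
    · have hd : 0 < d := by
        refine lt_max_of_lt_right ?_
        rw [sub_pos, div_lt_one (by norm_num)]
        gcongr
      have hu2 : ‖u‖ ^ 2 ≤ 16 := by nlinarith [norm_nonneg u]
      have hc : 15 / 16 ≤ c := by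
        refine le_max_of_le_right ?_
        linarith
      have hc1 : c ≤ 1 := cutoff_le_one _ _
      have hd1 : d ≤ 1 := cutoff_le_one _ _
      have hpu : |p u| ≤ 64 := by
        have h1 : |⟪jacobi u, u⟫_ℝ| ≤ (2 * ‖u‖) * ‖u‖ :=
          (abs_real_inner_le_norm _ _).trans (by
            gcongr
            exact jacobi.le_of_opNorm_le norm_jacobi_le u)
        rw [abs_mul, abs_two]
        nlinarith
      have hru : |r u| ≤ 4 := by
        refine (abs_real_inner_le_norm _ _).trans ?_
        rw [he1, one_mul]
        exact h4.le
      have h1 : |c * (4 / 16 ^ 2 * p u)| ≤ 1 := by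
        rw [abs_mul, abs_mul, abs_of_nonneg hc0, abs_of_pos (by norm_num : (0 : ℝ) < 4 / 16 ^ 2)]
        calc _ ≤ 1 * (4 / 16 ^ 2 * (64 : ℝ)) := by gcongr
          _ = 1 := by norm_num
      have h2 : |d * (4 / 4 ^ 2 * r u)| ≤ 1 := by
        rw [abs_mul, abs_mul, abs_of_nonneg hd0, abs_of_pos (by norm_num : (0 : ℝ) < 4 / 4 ^ 2)]
        calc _ ≤ 1 * (4 / 4 ^ 2 * (4 : ℝ)) := by gcongr
          _ = 1 := by norm_num
      have := source_eq_zero_of_jacobi heq (by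
        rw [abs_le] at h1 h2
        rw [abs_lt]
        constructor <;> nlinarith [h1.1, h1.2, h2.1, h2.2])
      exact hd.ne' (by simpa using this)
    -- Outside the small ball the source is absent, and the homogeneous equation forces `u = 0`,
    -- contrary to `4 ≤ ‖u‖`.
    · have hd : d = 0 := cutoff_eq_zero (by norm_num) h4
      rw [hd] at heq
      have h0 : u = 0 := by
        by_cases hc : c = 0
        · simpa [hc] using heq
        · exact eq_zero_of_jacobi (by simpa using heq) (by positivity)
      rw [h0, norm_zero] at h4
      norm_num at h4

end Model

/-! ### Hilbert sums and a gradient avoiding a dense subspace -/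

section HilbertSum

theorem lp.hasSum_norm_sq {H : Type*} [NormedAddCommGroup H] (x : lp (fun _ : ℕ => H) 2) : HasSum (fun k => ‖x k‖ ^ 2) (‖x‖ ^ 2) := by
  simpa using lp.hasSum_norm (p := 2) (by norm_num : 0 < (2 : ENNReal).toReal) x

variable {H : Type*} [NormedAddCommGroup H] [InnerProductSpace ℝ H]

/-- A Hilbert sum of functions with uniformly Lipschitz gradients, each at bounded distance from
the squared norm. -/
theorem exists_hasFDerivAt_hilbertSum {g : ℕ → H → ℝ} {G : ℕ → H → H} {c : ℕ → ℝ} {L δ : ℝ}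
    (hL : 0 ≤ L) (hc : HasSum c δ)
    (hg : ∀ k v, HasFDerivAt (g k) (innerSL ℝ (G k v)) v)
    (hG : ∀ k v w, ‖G k v - G k w‖ ≤ L * ‖v - w‖) (hG0 : Memℓp (fun k => G k 0) 2)
    (hgc : ∀ k v, |g k v - ‖v‖ ^ 2| ≤ c k) :
    ∃ (f : lp (fun _ : ℕ => H) 2 → ℝ) (F : lp (fun _ : ℕ => H) 2 → lp (fun _ : ℕ => H) 2),
      (∀ x, HasFDerivAt f (innerSL ℝ (F x)) x) ∧ (∀ x y, ‖F x - F y‖ ≤ L * ‖x - y‖) ∧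
      (∀ x, |f x - ‖x‖ ^ 2| ≤ δ) ∧ ∀ x k, F x k = G k (x k) := by
  have hmem : ∀ x : lp (fun _ : ℕ => H) 2, Memℓp (fun k => G k (x k)) 2 := fun x => by
    have h1 : Memℓp (fun k => G k (x k) - G k 0) 2 :=
      (lp.memℓp (L • x)).mono' fun k => by
        simpa [norm_smul, abs_of_nonneg hL] using hG k (x k) 0
    have h2 := h1.add hG0
    have h3 : ((fun k => G k (x k) - G k 0) + fun k => G k 0) = fun k => G k (x k) := by
      ext k; simp
    rwa [h3] at h2
  let F : lp (fun _ : ℕ => H) 2 → lp (fun _ : ℕ => H) 2 := fun x => ⟨fun k => G k (x k), hmem x⟩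
  have hF : ∀ x k, F x k = G k (x k) := fun x k => rfl
  have hsub : ∀ x : lp (fun _ : ℕ => H) 2, Summable fun k => g k (x k) - ‖x k‖ ^ 2 := fun x =>
    hc.summable.of_norm_bounded fun k => hgc k (x k)
  have hsum : ∀ x : lp (fun _ : ℕ => H) 2, Summable fun k => g k (x k) := fun x => by
    simpa using (hsub x).add (lp.hasSum_norm_sq x).summable
  refine ⟨fun x => ∑' k, g k (x k), F, fun x => ?_, fun x y => ?_, fun x => ?_, hF⟩
  -- The blockwise remainders `L * ‖y k - x k‖ ^ 2` sum to `L * ‖y - x‖ ^ 2`.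
  · refine hasFDerivAt_of_norm_sub_le_sq (C := L) fun y => ?_
    have h1 := ((hsum y).hasSum.sub (hsum x).hasSum).sub (lp.hasSum_inner (𝕜 := ℝ) (F x) (y - x))
    have h2 := (lp.hasSum_norm_sq (y - x)).mul_left L
    refine h1.norm_le_of_bounded h2 fun k => ?_
    have := norm_sub_le_sq_of_lipschitz_fderiv hL (hg k) (fun v w => by
      rw [← map_sub, innerSL_apply_norm]
      exact hG k v w) (x k) (y k)
    simpa [hF] using this
  · have h : ‖F x - F y‖ ≤ ‖L • (x - y)‖ := lp.norm_mono two_ne_zero fun k => by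
      rw [lp.coeFn_smul, Pi.smul_apply, norm_smul, Real.norm_of_nonneg hL]
      exact hG k (x k) (y k)
    rwa [norm_smul, Real.norm_of_nonneg hL] at h
  · have h := (hsum x).hasSum.sub (lp.hasSum_norm_sq x)
    exact h.norm_le_of_bounded hc fun k => hgc k (x k)

/-- The finitely supported elements of a Hilbert sum. -/
def finiteSupport (H : Type*) [NormedAddCommGroup H] [InnerProductSpace ℝ H] :
    Submodule ℝ (lp (fun _ : ℕ => H) 2) where
  carrier := {x | {k | x k ≠ 0}.Finite}
  zero_mem' := by simp
  add_mem' {x y} hx hy := by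
    refine (Set.Finite.union hx hy).subset fun k hk => ?_
    by_contra! h
    simp only [Set.mem_union, Set.mem_ofPred_eq, not_or, not_not] at h
    exact hk (by simp [h.1, h.2])
  smul_mem' c x hx := by
    refine Set.Finite.subset hx fun k hk h => hk ?_
    simp [h]

theorem dense_finiteSupport : Dense (finiteSupport H : Set (lp (fun _ : ℕ => H) 2)) := by
  intro x
  refine mem_closure_of_tendsto (lp.hasSum_single (by norm_num) x) (.of_forall fun s => ?_)
  refine Submodule.sum_mem _ fun k _ => ?_
  refine (Set.finite_singleton k).subset fun j hj => ?_
  by_contra hjk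
  exact hj (by simp [Pi.single_eq_of_ne (show j ≠ k from hjk)])

/-- The Hilbert sum of countably many copies of `ℓ²` is isometric to `ℓ²`. -/
theorem nonempty_linearIsometryEquiv_hilbertSum :
    Nonempty (lp (fun _ : ℕ => Ell2) 2 ≃ₗᵢ[ℝ] Ell2) := by
  -- The doubly indexed standard basis, enumerated by the pairing function.
  let v : ℕ → lp (fun _ : ℕ => Ell2) 2 := fun m =>
    lp.single 2 m.unpair.1 (lp.single 2 m.unpair.2 (1 : ℝ) : Ell2)
  have hv : Orthonormal ℝ v := by
    rw [orthonormal_iff_ite]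
    intro i j
    simp only [v, lp.inner_single_left, lp.coeFn_single, Pi.single_apply]
    by_cases h1 : i.unpair.1 = j.unpair.1
    · by_cases h2 : i.unpair.2 = j.unpair.2
      · have : i = j := Nat.pairEquiv.symm.injective (Prod.ext h1 h2)
        simp [this]
      · have : i ≠ j := fun h => h2 (by rw [h])
        simp [this, h1, h2]
    · have : i ≠ j := fun h => h1 (by rw [h])
      simp [this, h1]
  refine ⟨(HilbertBasis.mkOfOrthogonalEqBot hv ?_).repr⟩
  rw [Submodule.eq_bot_iff]
  intro x hx
  ext k n
  have := (Submodule.mem_orthogonal _ x).1 hx (v (Nat.pair k n)) (Submodule.subset_span ⟨_, rfl⟩)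
  simpa [v, lp.inner_single_left] using this

end HilbertSum

/-- There are functions on `ℓ²` uniformly close to the squared norm, with Lipschitz gradient
avoiding a dense subspace. -/
theorem exists_lipschitz_gradient_notMem_dense {δ : ℝ} (hδ : 0 < δ) :
    ∃ (f : Ell2 → ℝ) (F : Ell2 → Ell2) (L : ℝ) (D : Submodule ℝ Ell2), 0 ≤ L ∧
      (∀ x, HasFDerivAt f (innerSL ℝ (F x)) x) ∧ (∀ x y, ‖F x - F y‖ ≤ L * ‖x - y‖) ∧
      (∀ x, |f x - ‖x‖ ^ 2| ≤ δ) ∧ Dense (D : Set Ell2) ∧ ∀ x, F x ∉ D := by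
  obtain ⟨g, G, C, L, hC, hL, hg, hG, hgC, hG0⟩ := exists_lipschitz_gradient_ne_zero
  -- Dividing by `C + 1` rather than `C` covers `C = 0`.
  obtain ⟨a, ha, S, hS, hSδ⟩ := posSumOfEncodable (show 0 < δ / (C + 1) by positivity) ℕ
  have hs : ∀ k, 0 < √(a k) := fun k => Real.sqrt_pos.2 (ha k)
  have hss : ∀ k, √(a k) ^ 2 = a k := fun k => Real.sq_sqrt (ha k).le
  -- The scaling `a * g (v / √a)` fixes `‖v‖ ^ 2` and the Lipschitz constant of the gradient, while
  -- shrinking the distance to `‖v‖ ^ 2` by the factor `a`.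
  obtain ⟨f, F, hf, hF, hfδ, hFG⟩ := exists_hasFDerivAt_hilbertSum
    (g := fun k v => a k * g ((√(a k))⁻¹ • v)) (G := fun k v => √(a k) • G ((√(a k))⁻¹ • v))
    (c := fun k => C * a k) hL (hS.mul_left C)
    (fun k v => by
      have h1 : HasFDerivAt (fun v : Ell2 => (√(a k))⁻¹ • v)
        ((√(a k))⁻¹ • ContinuousLinearMap.id ℝ Ell2) v :=
        ((√(a k))⁻¹ • ContinuousLinearMap.id ℝ Ell2).hasFDerivAt
      refine (((hg _).comp v h1).const_mul (a k)).congr_fderiv ?_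
      ext w
      have h2 := (hs k).ne'
      simp only [smul_apply, ContinuousLinearMap.comp_apply, innerSL_apply_apply, smul_eq_mul,
        ContinuousLinearMap.id_apply, inner_smul_left, inner_smul_right, conj_trivial]
      nth_rw 1 [← hss k]
      field_simp)
    (fun k v w => by
      rw [← smul_sub, norm_smul, Real.norm_of_nonneg (hs k).le]
      refine (mul_le_mul_of_nonneg_left (hG _ _) (hs k).le).trans_eq ?_
      rw [← smul_sub, norm_smul, norm_inv, Real.norm_of_nonneg (hs k).le]
      have h2 := (hs k).ne'
      field_simp)
    (by
      rw [memℓp_gen_iff (by norm_num)]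
      simpa [norm_smul, mul_pow, hss] using hS.summable.mul_right (‖G 0‖ ^ 2))
    (fun k v => by
      have h1 : a k * g ((√(a k))⁻¹ • v) - ‖v‖ ^ 2
          = a k * (g ((√(a k))⁻¹ • v) - ‖(√(a k))⁻¹ • v‖ ^ 2) := by
        rw [norm_smul, mul_pow, norm_inv, Real.norm_of_nonneg (hs k).le, inv_pow, hss, mul_sub,
          mul_inv_cancel_left₀ (ha k).ne']
      rw [h1, abs_mul, abs_of_pos (ha k), mul_comm]
      exact mul_le_mul_of_nonneg_right (hgC _) (ha k).le)
  obtain ⟨Φ⟩ := nonempty_linearIsometryEquiv_hilbertSum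
  refine ⟨fun x => f (Φ.symm x), fun x => Φ (F (Φ.symm x)), L,
    (finiteSupport Ell2).comap (Φ.symm.toLinearEquiv : Ell2 →ₗ[ℝ] _), hL, fun x => ?_,
    fun x y => ?_, fun x => ?_, ?_, fun x hx => ?_⟩
  · refine ((hf (Φ.symm x)).comp x Φ.symm.toContinuousLinearEquiv.hasFDerivAt).congr_fderiv ?_
    ext w
    simpa using (Φ.inner_map_map (F (Φ.symm x)) (Φ.symm w)).symm
  · rw [← map_sub, Φ.norm_map]
    refine (hF _ _).trans_eq ?_
    rw [← map_sub, Φ.symm.norm_map]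
  · rw [← Φ.symm.norm_map]
    refine (hfδ _).trans ?_
    calc C * S ≤ C * (δ / (C + 1)) := by gcongr
      _ = δ * (C / (C + 1)) := by ring
      _ ≤ δ * 1 := by
        gcongr
        rw [div_le_one (by positivity)]
        linarith
      _ = δ := mul_one δ
  · exact dense_finiteSupport.preimage Φ.symm.toHomeomorph.isOpenMap
  · have h1 : F (Φ.symm x) ∈ finiteSupport Ell2 := by simpa using hx
    have h2 : {k | F (Φ.symm x) k ≠ 0} = Set.univ := by
      ext k
      simpa [hFG, (hs k).ne'] using hG0 _
    have h3 : {k | F (Φ.symm x) k ≠ 0}.Finite := h1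
    rw [h2] at h3
    exact Set.infinite_univ h3

/-! ### Cones of derivatives, square roots and truncation -/

section Cone

variable {E : Type*} [NormedAddCommGroup E] [InnerProductSpace ℝ E]

/-- A cone of derivatives meeting a dense subspace of the dual only at zero has empty interior. -/
theorem interior_derivativeCone_eq_empty [CompleteSpace E] [Nontrivial E] {f : E → ℝ}
    {F : E → E} {D : Submodule ℝ E} (hD : Dense (D : Set E)) (hF : ∀ x, fderiv ℝ f x = innerSL ℝ (F x))
    (h : ∀ x, F x ∈ D → F x = 0) : interior (derivativeCone f) = ∅ := by
  by_contra! hne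
  let T := InnerProductSpace.toDual ℝ E
  have hT : ∀ v, T v = innerSL ℝ v := fun v => by ext w; simp [T]
  have hne' : (T ⁻¹' interior (derivativeCone f)).Nonempty := hne.preimage T.surjective
  have ho : IsOpen (T ⁻¹' interior (derivativeCone f)) := isOpen_interior.preimage T.continuous
  -- The origin must be removed, since the cone always contains it.
  have hD' : Dense ((D : Set E) \ {0}) := hD.sdiff_singleton 0
  obtain ⟨v, hv, hvD, hv0⟩ := hD'.inter_open_nonempty _ ho hne'
  obtain ⟨c, -, x, hx⟩ := interior_subset hv
  have hvc : v = c • F x := by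
    apply T.injective
    rw [hx, hF, hT, map_smul]
  have hc : c ≠ 0 := by
    rintro rfl
    exact hv0 (by simpa using hvc)
  have hFD : F x ∈ D := by
    rw [hvc] at hvD
    exact (D.smul_mem_iff hc).1 hvD
  exact hv0 (by simp [hvc, h x hFD])

theorem isC1LipschitzWithLipschitzDeriv_of_gradient {f : E → ℝ} {F : E → E}
    (hf : ∀ x, HasFDerivAt f (innerSL ℝ (F x)) x) (hF : BoundedLipschitzOn F Set.univ) :
    IsC1LipschitzWithLipschitzDeriv f := by
  obtain ⟨K, hK, hF1, hF2⟩ := hF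
  lift K to NNReal using hK
  have hd : fderiv ℝ f = fun x => innerSL ℝ (F x) := funext fun x => (hf x).fderiv
  have hlip : LipschitzWith K (fderiv ℝ f) := by
    refine .of_dist_le_mul fun x y => ?_
    rw [hd, dist_eq_norm, dist_eq_norm, ← map_sub, innerSL_apply_norm]
    exact hF2 x trivial y trivial
  refine ⟨contDiff_one_iff_fderiv.2 ⟨fun x => (hf x).differentiableAt, hlip.continuous⟩,
    ⟨K, lipschitzWith_of_nnnorm_fderiv_le (fun x => (hf x).differentiableAt) fun x => ?_⟩,
    K, hlip⟩
  rw [hd, ← NNReal.coe_le_coe, coe_nnnorm, innerSL_apply_norm]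
  exact hF1 x trivial

theorem abs_sub_le_of_norm_gradient_le {f : E → ℝ} {F : E → E}
    (hf : ∀ x, HasFDerivAt f (innerSL ℝ (F x)) x) {K : ℝ} (hK : ∀ x, ‖F x‖ ≤ K) (x y : E) :
    |f x - f y| ≤ K * ‖x - y‖ :=
  convex_univ.norm_image_sub_le_of_norm_hasFDerivWithin_le
    (fun z _ => (hf z).hasFDerivWithinAt) (fun z _ => by rw [innerSL_apply_norm]; exact hK z)
    trivial trivial

/-- The square root of a positive function of quadratic growth with Lipschitz gradient. -/
theorem exists_gradient_sqrt {f : E → ℝ} {F : E → E} {L m : ℝ} (hL : 0 ≤ L) (hm : 0 < m)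
    (hf : ∀ x, HasFDerivAt f (innerSL ℝ (F x)) x) (hF : ∀ x y, ‖F x - F y‖ ≤ L * ‖x - y‖)
    (hfm : ∀ x, ‖x‖ ^ 2 + m ^ 2 ≤ f x) :
    (∀ x, HasFDerivAt (fun x => √(f x)) (innerSL ℝ ((2 * √(f x))⁻¹ • F x)) x) ∧
      BoundedLipschitzOn (fun x => (2 * √(f x))⁻¹ • F x) Set.univ := by
  have hpos : ∀ x, 0 < f x := fun x => lt_of_lt_of_le (by positivity) (hfm x)
  have hspos : ∀ x, 0 < √(f x) := fun x => Real.sqrt_pos.2 (hpos x)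
  have hms : ∀ x, m ≤ √(f x) := fun x =>
    Real.le_sqrt_of_sq_le ((le_add_of_nonneg_left (sq_nonneg _)).trans (hfm x))
  have hns : ∀ x, ‖x‖ ≤ √(f x) := fun x =>
    Real.le_sqrt_of_sq_le ((le_add_of_nonneg_right (sq_nonneg _)).trans (hfm x))
  have hd : ∀ x, HasFDerivAt (fun x => √(f x)) (innerSL ℝ ((2 * √(f x))⁻¹ • F x)) x := fun x => by
    refine ((hf x).sqrt (hpos x).ne').congr_fderiv ?_
    ext w
    simp
  -- `F` grows at most linearly, and `√(f x)` dominates both `m` and `‖x‖`.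
  set C := ‖F 0‖ / m + L with hC
  have hFC : ∀ x, ‖F x‖ ≤ C * √(f x) := fun x => by
    have h1 : ‖F x‖ ≤ ‖F 0‖ + L * ‖x‖ := by
      have h2 := hF x 0
      rw [sub_zero] at h2
      linarith [norm_le_norm_add_norm_sub' (F x) (F 0)]
    have h2 : ‖F 0‖ ≤ ‖F 0‖ / m * √(f x) := by
      rw [div_mul_eq_mul_div, le_div_iff₀ hm]
      gcongr
      exact hms x
    have h3 : L * ‖x‖ ≤ L * √(f x) := by gcongr; exact hns x
    rw [hC, add_mul]
    linarith
  have hC0 : 0 ≤ C := by positivity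
  have hbd : ∀ x, ‖(2 * √(f x))⁻¹ • F x‖ ≤ C := fun x => by
    rw [norm_smul, norm_inv, Real.norm_of_nonneg (by positivity), inv_mul_le_iff₀
      (by linarith [hspos x])]
    nlinarith [hFC x, hspos x, mul_nonneg hC0 (hspos x).le]
  refine ⟨hd, ?_⟩
  have hslip := abs_sub_le_of_norm_gradient_le hd hbd
  suffices h : ∀ x y, ‖(2 * √(f x))⁻¹ • F x - (2 * √(f y))⁻¹ • F y‖
      ≤ (L + C * C) / m * ‖x - y‖ by
    refine ⟨C + (L + C * C) / m, by positivity, fun x _ => ?_, fun x _ y _ => (h x y).trans ?_⟩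
    · exact (hbd x).trans (le_add_of_nonneg_right (by positivity))
    · gcongr
      exact le_add_of_nonneg_left hC0
  intro x y
  have hx := hspos x
  have hy := hspos y
  -- Factoring out the weight at `x` leaves a relative change of `√f`, controlled by its Lipschitz
  -- constant `C`; dividing by `√(f y)` absorbs the growth of `F y`.
  have key : (2 * √(f x))⁻¹ • F x - (2 * √(f y))⁻¹ • F y
      = (2 * √(f x))⁻¹ • ((F x - F y) + ((√(f y) - √(f x)) / √(f y)) • F y) := by
    have h1 : (2 * √(f y))⁻¹ = (2 * √(f x))⁻¹ * (1 - (√(f y) - √(f x)) / √(f y)) := by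
      field_simp
      ring
    rw [h1]
    module
  have h2 : ‖((√(f y) - √(f x)) / √(f y)) • F y‖ ≤ C * C * ‖x - y‖ := by
    rw [norm_smul, norm_div, Real.norm_of_nonneg hy.le, div_mul_eq_mul_div, div_le_iff₀ hy,
      Real.norm_eq_abs, abs_sub_comm]
    calc _ ≤ (C * ‖x - y‖) * (C * √(f y)) := by gcongr; exacts [hslip x y, hFC y]
      _ = _ := by ring
  rw [key, norm_smul, norm_inv, Real.norm_of_nonneg (by positivity), div_mul_eq_mul_div,
    le_div_iff₀ hm, mul_comm, ← mul_assoc]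
  have h3 : m * (2 * √(f x))⁻¹ ≤ 1 := by
    rw [mul_inv_le_iff₀ (by positivity)]
    linarith [hms x]
  calc _ ≤ 1 * (L * ‖x - y‖ + C * C * ‖x - y‖) := by
        gcongr
        exact (norm_add_le _ _).trans (add_le_add (hF x y) h2)
    _ = _ := by ring

/-- A function cut off above its unit level: `max 0 (1 - f) ^ 2`. -/
theorem hasFDerivAt_max_zero_one_sub_sq {f : E → ℝ} {F : E → E}
    (hf : ∀ x, HasFDerivAt f (innerSL ℝ (F x)) x) (x : E) :
    HasFDerivAt (fun x => max 0 (1 - f x) ^ 2) (innerSL ℝ (max 0 (1 - f x) • (-2 : ℝ) • F x)) x := by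
  refine ((hasDerivAt_max_zero_sq _).comp_hasFDerivAt x ((hf x).const_sub 1)).congr_fderiv ?_
  ext w
  simp
  ring

/-- On the support `f ≤ 1`, so an interior point with `1 ≤ f x` would be a local maximum of `f`. -/
theorem notMem_interior_tsupport_of_one_le {f : E → ℝ} {x : E} (hd : fderiv ℝ f x ≠ 0) (hfx : 1 ≤ f x)
    (hf : Continuous f) : x ∉ interior (tsupport fun x => max 0 (1 - f x) ^ 2) := by
  have hle : ∀ y ∈ tsupport fun x => max 0 (1 - f x) ^ 2, f y ≤ 1 := by
    refine closure_minimal (fun y hy => ?_) (isClosed_le hf continuous_const)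
    refine show f y ≤ 1 from le_of_not_gt fun h => hy ?_
    simp [max_eq_left (sub_nonpos.2 h.le)]
  intro hx
  refine hd (IsLocalMax.fderiv_eq_zero ?_)
  filter_upwards [isOpen_interior.mem_nhds hx] with y hy
  exact (hle y (interior_subset hy)).trans hfx

end Cone

/-- There are functions on `ℓ²` uniformly close to the norm, with bounded Lipschitz gradient
avoiding a dense subspace. -/
theorem exists_approx_norm_gradient_notMem_dense {ε : ℝ} (hε : 0 < ε) :
    ∃ (ψ : Ell2 → ℝ) (Ψ : Ell2 → Ell2) (D : Submodule ℝ Ell2),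
      (∀ x, HasFDerivAt ψ (innerSL ℝ (Ψ x)) x) ∧ BoundedLipschitzOn Ψ Set.univ ∧
      (∀ x, |ψ x - ‖x‖| ≤ ε) ∧ Dense (D : Set Ell2) ∧ ∀ x, Ψ x ∉ D := by
  -- With error `ε ^ 2 / 4` and shift `ε ^ 2 / 2`, the radicand lies between `‖x‖ ^ 2 + (ε / 2) ^ 2`
  -- and `‖x‖ ^ 2 + 3 * ε ^ 2 / 4`, the latter at most `(‖x‖ + ε) ^ 2`.
  obtain ⟨f, F, L, D, hL, hf, hF, hfδ, hD, hFD⟩ :=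
    exists_lipschitz_gradient_notMem_dense (show 0 < ε ^ 2 / 4 by positivity)
  have hlow : ∀ x, ‖x‖ ^ 2 + (ε / 2) ^ 2 ≤ f x + ε ^ 2 / 2 := fun x => by
    have := (abs_le.1 (hfδ x)).1
    linarith
  obtain ⟨hd, hreg⟩ := exists_gradient_sqrt hL (half_pos hε)
    (fun x => (hf x).add_const (ε ^ 2 / 2)) hF hlow
  have hpos : ∀ x, (2 * √(f x + ε ^ 2 / 2))⁻¹ ≠ 0 := fun x => by
    have : 0 < f x + ε ^ 2 / 2 := lt_of_lt_of_le (by positivity) (hlow x)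
    have := Real.sqrt_pos.2 this
    positivity
  refine ⟨fun x => √(f x + ε ^ 2 / 2), _, D, hd, hreg, fun x => ?_, hD,
    fun x h => hFD x ((D.smul_mem_iff (hpos x)).1 h)⟩
  have h1 : ‖x‖ ≤ √(f x + ε ^ 2 / 2) :=
    Real.le_sqrt_of_sq_le ((le_add_of_nonneg_right (sq_nonneg _)).trans (hlow x))
  have h2 : √(f x + ε ^ 2 / 2) ≤ ‖x‖ + ε := by
    refine Real.sqrt_le_iff.2 ⟨by positivity, ?_⟩
    have := (abs_le.1 (hfδ x)).2
    nlinarith [norm_nonneg x, mul_nonneg (norm_nonneg x) hε.le, sq_nonneg ε]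
  rw [abs_le]
  constructor <;> linarith

theorem fderiv_ne_zero_of_gradient {f : Ell2 → ℝ} {v x : Ell2}
    (hf : HasFDerivAt f (innerSL ℝ v) x) (hv : v ≠ 0) : fderiv ℝ f x ≠ 0 := by
  rwa [hf.fderiv, ← norm_ne_zero_iff, innerSL_apply_norm, norm_ne_zero_iff]

instance Ell2.nontrivial : Nontrivial Ell2 :=
  ⟨lp.single 2 0 (1 : ℝ), 0, by rw [← norm_ne_zero_iff]; simp [lp.norm_single]⟩

theorem exists_approx_norm {ε : ℝ} (hε : 0 < ε) : ∃ ψ : Ell2 → ℝ,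
    IsC1LipschitzWithLipschitzDeriv ψ ∧ (∀ x : Ell2, |ψ x - ‖x‖| ≤ ε) ∧
      interior (derivativeCone ψ) = ∅ ∧ ∀ x : Ell2, fderiv ℝ ψ x ≠ 0 := by
  obtain ⟨ψ, Ψ, D, hd, hΨ, hε', hD, hΨD⟩ := exists_approx_norm_gradient_notMem_dense hε
  exact ⟨ψ, isC1LipschitzWithLipschitzDeriv_of_gradient hd hΨ, hε',
    interior_derivativeCone_eq_empty hD (fun x => (hd x).fderiv) fun x hx => absurd hx (hΨD x),
    fun x => fderiv_ne_zero_of_gradient (hd x) fun h => hΨD x (h ▸ D.zero_mem)⟩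

theorem exists_bump : ∃ b : Ell2 → ℝ, IsBump b ∧ IsC1LipschitzWithLipschitzDeriv b ∧
    interior (derivativeCone b) = ∅ ∧ ∀ x ∈ interior (tsupport b), fderiv ℝ b x ≠ 0 := by
  -- Error `1/2` gives `ψ 0 < 1`, and `ψ ≥ 1` wherever `‖x‖ > 2`.
  obtain ⟨ψ, Ψ, D, hψ, hΨ, hε, hD, hΨD⟩ := exists_approx_norm_gradient_notMem_dense one_half_pos
  have hΨ0 : ∀ x, Ψ x ≠ 0 := fun x h => hΨD x (h ▸ D.zero_mem)
  have hψc : Continuous ψ := continuous_iff_continuousAt.2 fun x => (hψ x).continuousAt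
  have hd := hasFDerivAt_max_zero_one_sub_sq hψ
  have hc : BoundedLipschitzOn (fun x => max 0 (1 - ψ x)) Set.univ := by
    obtain ⟨K, hK, hΨ1, -⟩ := hΨ
    have hlip := abs_sub_le_of_norm_gradient_le hψ fun x => hΨ1 x trivial
    refine ⟨3 / 2 + K, by positivity, fun x _ => ?_, fun x _ y _ => ?_⟩
    · rw [Real.norm_of_nonneg (le_max_left _ _)]
      refine max_le (by positivity) ?_
      linarith [(abs_le.1 (hε x)).1, norm_nonneg x]
    · have h1 := abs_max_sub_max_le_max 0 (1 - ψ x) 0 (1 - ψ y)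
      rw [sub_self, abs_zero, sub_sub_sub_cancel_left, abs_sub_comm (ψ y),
        max_eq_right (a := (0 : ℝ)) (abs_nonneg _)] at h1
      have : 0 ≤ 3 / 2 * ‖x - y‖ := by positivity
      rw [Real.norm_eq_abs, add_mul]
      linarith [hlip x y]
  refine ⟨fun x => max 0 (1 - ψ x) ^ 2, ⟨⟨0, ?_⟩, ?_⟩,
    isC1LipschitzWithLipschitzDeriv_of_gradient hd (hc.smul ((BoundedLipschitzOn.const _).smul hΨ)),
    interior_derivativeCone_eq_empty hD (fun x => (hd x).fderiv) fun x hx => ?_, fun x hx => ?_⟩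
  · have h1 := (abs_le.1 (hε 0)).2
    rw [norm_zero] at h1
    have : 0 < max 0 (1 - ψ 0) := lt_max_of_lt_right (by linarith)
    positivity
  · refine (Metric.isBounded_closedBall (x := (0 : Ell2)) (r := 2)).subset
      (closure_minimal (fun x hx => ?_) Metric.isClosed_closedBall)
    rw [mem_closedBall_zero_iff]
    by_contra! h
    refine hx ?_
    have : 1 - ψ x ≤ 0 := by linarith [(abs_le.1 (hε x)).1]
    simp [max_eq_left this]
  -- The gradient of the bump may vanish, but where it does not it is a nonzero multiple of `Ψ x`,
  -- hence outside `D`.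
  · by_contra hne
    have hne' : max 0 (1 - ψ x) ≠ 0 := fun h => hne (by rw [h, zero_smul])
    exact hΨD x ((D.smul_mem_iff (by norm_num : (-2 : ℝ) ≠ 0)).1 ((D.smul_mem_iff hne').1 hx))
  · have hlt : ψ x < 1 := by
      by_contra! h
      exact notMem_interior_tsupport_of_one_le (fderiv_ne_zero_of_gradient (hψ x) (hΨ0 x)) h hψc hx
    refine fderiv_ne_zero_of_gradient (hd x) (smul_ne_zero ?_ (smul_ne_zero (by norm_num) (hΨ0 x)))
    exact (lt_max_of_lt_right (by linarith)).ne'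

theorem theorem4p3 :
    (∀ ε : ℝ, 0 < ε → ∃ ψ : Ell2 → ℝ,
      IsC1LipschitzWithLipschitzDeriv ψ ∧
      (∀ x : Ell2, |ψ x - ‖x‖| ≤ ε) ∧
      interior (derivativeCone ψ) = ∅ ∧
      ∀ x : Ell2, fderiv ℝ ψ x ≠ 0) ∧
    (∃ b : Ell2 → ℝ,
      IsBump b ∧
      IsC1LipschitzWithLipschitzDeriv b ∧
      interior (derivativeCone b) = ∅ ∧
      ∀ x ∈ interior (tsupport b), fderiv ℝ b x ≠ 0) :=
  ⟨fun _ hε => exists_approx_norm hε, exists_bump⟩
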